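/- \textbf{Model.} Time is divided into cycles, each consisting of a transmission step (fully processed packets leave the queue), an arrival step (packets arrive; the algorithm decides which of the buffered and arriving packets to retain, at most $B$ in total, where $B\ge 1$ is the buffer size; the others are lost) and a processing step (at most one buffered packet receives one cycle of processing). Each packet $p$ has a work $w(p)\in\{W_0,\dots,W\}$ (the number of processing cycles it needs) and a profit $v(p)\in\{1,\dots,V\}$, where $V,W,W_0$ are integers with $V\ge 1$, $1\le W_0\le W$, $W\ge 2$. The pair $(w(p),v(p))$ is revealed to an online algorithm either on arrival (known packets) or only after the first processing cycle of $p$ (unknown packets). At most $M\ge1$ unknown packets arrive in any cycle. The throughput of an algorithm on a finite arrival sequence is the total profit of the packets it transmits. A randomized online algorithm is a probability distribution over deterministic online algorithms. It is $\rho$-competitive against offline algorithms with buffer size $B'$ if on every finite arrival sequence no offline (clairvoyant) schedule with a buffer of size $B'$ has throughput larger than $\rho$ times the expected throughput of the algorithm; the usual notion is $B'=B$. Put $$L(V,W,W_0,M)=\frac{V(W-1)}{2W_0}\left[1-\left(1-\frac{1}{V(W-1)+1-W_0}\right)^{MW_0}\right].$$ \textbf{Theorem.} \begin{enumerate} \item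 Let $V\ge1$, $1\le W_0\le W$, $W\ge2$ be integers, with $W_0<W$ or $V>1$. If $M$ is an integer with $1\le M\le \frac{V(W-1)}{W_0}$, then $L(V,W,W_0,M)\ge \frac M4$. \item Let $V\ge1$, $1\le W_0\le W$, $W\ge2$ be integers, with $W_0<W$ or $V>1$. If $M$ is an integer with $M>\frac{V(W-1)}{W_0}$, then $L(V,W,W_0,M)>\frac{e-1}{4e}\cdot\frac{VW}{W_0}$. \item Let $W_0=1$, $V\ge1$, $W\ge2$, $M\ge1$, and let the buffer sizes $B,B'\ge1$ be arbitrary. If a randomized online algorithm with buffer size $B$ is $\rho$-competitive against offline algorithms with buffer size $B'$ (in particular for $B'=B$, and even for $B'=1$), then $$\rho\ \ge\ L(V,W,1,M)\qquad\text{and}\qquad \rho\ \ge\ \frac{e-1}{4e}\,\min\{VW,M\}.$$ In particular, the competitive ratio of every randomized online algorithm is $\Omega(\min\{VW,M\})$, with an absolute constant. \end{enumerate} -/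

import Mathlib

open MeasureTheory

namespace PacketQueue

/-- A unit-size packet: its required work (number of processing cycles), its profit, and whether
these two characteristics are known upon arrival (a `K`-packet) or not (a `U`-packet). -/
structure Packet where
  work : ℕ
  profit : ℕ
  known : Bool

/-- A finite arrival sequence: the packets arriving in cycle `t` are the `t`-th list.
After the last listed cycle there are no further arrivals. -/
abbrev Input := List (List Packet)

/-- A packet is identified by its arrival cycle and its position among the arrivals of that cycle. -/
abbrev PacketId := ℕ × ℕ

/-- The packets arriving in cycle `t`. -/
def arrivalList (σ : Input) (t : ℕ) : List Packet := σ.getD t []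

/-- The identifiers of the packets arriving in cycle `t`. -/
def arrivals (σ : Input) (t : ℕ) : Finset PacketId :=
  (Finset.range (arrivalList σ t).length).image fun i => (t, i)

/-- The identifiers of all packets of the arrival sequence. -/
def allIds (σ : Input) : Finset PacketId :=
  (Finset.range σ.length).biUnion (arrivals σ)

/-- The packet with a given identifier, if there is one. -/
def packet? (σ : Input) (q : PacketId) : Option Packet := (arrivalList σ q.1)[q.2]?

def workOf (σ : Input) (q : PacketId) : ℕ := ((packet? σ q).map Packet.work).getD 0

def profitOf (σ : Input) (q : PacketId) : ℕ := ((packet? σ q).map Packet.profit).getD 0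

/-- The arrival sequences of the model: works in `{W₀, …, W}`, profits in `{1, …, V}`,
and at most `M` `U`-packets per cycle (any number of `K`-packets). -/
def Admissible (V W W₀ M : ℕ) (σ : Input) : Prop :=
  ∀ a ∈ σ, (∀ p ∈ a, (W₀ ≤ p.work ∧ p.work ≤ W) ∧ (1 ≤ p.profit ∧ p.profit ≤ V)) ∧
    a.countP (fun p => !p.known) ≤ M

/-- What a queue management algorithm does, cycle by cycle: `keep t` is the buffer content after the
arrival step of cycle `t`, and `serve t` is the packet processed in the processing step of cycle
`t` (`none` if the processor is idle). -/
structure Schedule where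
  keep : ℕ → Finset PacketId
  serve : ℕ → Option PacketId

namespace Schedule

/-- The number of processing cycles given to packet `q` in the cycles before cycle `t`. -/
def servedBefore (S : Schedule) (q : PacketId) (t : ℕ) : ℕ :=
  ((Finset.range t).filter fun s => S.serve s = some q).card

/-- The packets of the buffer that are fully processed at the end of cycle `t`;
they leave the queue in the transmission step of cycle `t + 1`. -/
def completed (S : Schedule) (σ : Input) (t : ℕ) : Finset PacketId :=
  (S.keep t).filter fun q => workOf σ q ≤ S.servedBefore q (t + 1)

/-- The buffer content just before the arrival step of cycle `t`, after the transmission step. -/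
def carried (S : Schedule) (σ : Input) : ℕ → Finset PacketId
  | 0 => ∅
  | t + 1 => S.keep t \ S.completed σ t

/-- The schedule respects the arrivals and a buffer of size `B`: in each arrival step the retained
packets are taken from the buffered and the newly arriving ones, there are at most `B` of them,
and only a buffered packet can be processed. A dropped packet never returns. -/
def Feasible (S : Schedule) (B : ℕ) (σ : Input) : Prop :=
  ∀ t, S.keep t ⊆ S.carried σ t ∪ arrivals σ t ∧ (S.keep t).card ≤ B ∧
    ∀ q, S.serve t = some q → q ∈ S.keep t

open Classical in
/-- The throughput: the overall profit of all packets that are ever transmitted. -/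
noncomputable def throughput (S : Schedule) (σ : Input) : ℕ :=
  ∑ q ∈ (allIds σ).filter (fun q => ∃ t, q ∈ S.completed σ t), profitOf σ q

end Schedule

/-- What an online algorithm learns in one cycle, up to its arrival step: the arriving packets, with
`(work, profit)` shown for `K`-packets and hidden (`none`) for `U`-packets, and the characteristics
of the packet (if any) which it processed in the previous cycle. -/
structure Observation where
  arriving : List (Option (ℕ × ℕ))
  revealed : Option (ℕ × ℕ)

/-- A deterministic online algorithm: as a function of all observations made up to now, it decides
which packets to have in the buffer after the arrival step and which packet to process. -/
abbrev OnlineAlg := List Observation → Finset PacketId × Option PacketId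

/-- The arrivals of cycle `t` as seen on arrival. -/
def visible (σ : Input) (t : ℕ) : List (Option (ℕ × ℕ)) :=
  (arrivalList σ t).map fun p => if p.known then some (p.work, p.profit) else none

/-- The characteristics learned by processing packet `q`. -/
def reveal (σ : Input) (q : Option PacketId) : Option (ℕ × ℕ) :=
  (q.bind (packet? σ)).map fun p => (p.work, p.profit)

namespace OnlineAlg

/-- The observations made by the algorithm `A` on the input `σ` in the cycles `0, …, t`. -/
def history (A : OnlineAlg) (σ : Input) : ℕ → List Observation
  | 0 => [⟨visible σ 0, none⟩]
  | t + 1 => history A σ t ++ [⟨visible σ (t + 1), reveal σ (A (history A σ t)).2⟩]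

/-- The schedule produced by the algorithm `A` on the input `σ`. -/
def run (A : OnlineAlg) (σ : Input) : Schedule where
  keep t := (A (history A σ t)).1
  serve t := (A (history A σ t)).2

end OnlineAlg

/-- A randomized online algorithm with a buffer of size `B`: a random deterministic online algorithm
that always produces a feasible schedule. Measurability makes the expected throughput meaningful
(the throughput on a given input is bounded). -/
structure RandomizedAlg (V W W₀ M B : ℕ) where
  Ω : Type*
  [mΩ : MeasurableSpace Ω]
  μ : Measure Ω
  [prob : IsProbabilityMeasure μ]
  alg : Ω → OnlineAlg
  feasible : ∀ ω σ, Admissible V W W₀ M σ → ((alg ω).run σ).Feasible B σ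
  measurable_throughput : ∀ σ, Admissible V W W₀ M σ →
    Measurable fun ω => ((alg ω).run σ).throughput σ

namespace RandomizedAlg

variable {V W W₀ M B : ℕ}

/-- The expected throughput of a randomized algorithm on the input `σ`. -/
noncomputable def expectedThroughput (R : RandomizedAlg V W W₀ M B) (σ : Input) : ℝ :=
  letI : MeasurableSpace R.Ω := R.mΩ
  ∫ ω, (((R.alg ω).run σ).throughput σ : ℝ) ∂(R.μ)

/-- `R` is `ρ`-competitive against offline algorithms with a buffer of size `B'`: for every finite
input sequence, no schedule with a buffer of size `B'` has a throughput of more than `ρ` times the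
expected throughput of `R`. The usual notion is the case `B' = B`. -/
def IsCompetitive (R : RandomizedAlg V W W₀ M B) (B' : ℕ) (ρ : ℝ) : Prop :=
  ∀ σ, Admissible V W W₀ M σ → ∀ S : Schedule, S.Feasible B' σ →
    (S.throughput σ : ℝ) ≤ ρ * R.expectedThroughput σ

end RandomizedAlg

/-- The quantity `V (W - 1) / (2 W₀) * [1 - (1 - 1 / (V (W - 1) + 1 - W₀)) ^ (M W₀)]`. -/
noncomputable def lowerBound (V W W₀ M : ℕ) : ℝ :=
  (V : ℝ) * ((W : ℝ) - 1) / (2 * (W₀ : ℝ)) *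
    (1 - (1 - 1 / ((V : ℝ) * ((W : ℝ) - 1) + 1 - (W₀ : ℝ))) ^ (M * W₀))

end PacketQueue

namespace PacketQueue

/-! ### Estimates for `lowerBound` -/

/-! The competitive bound follows Yao's principle. Let `T` cycles bring `M` unknown packets each.
Independently, a packet is good (work 1, profit `V`) with probability `1/N`, where `N = V(W-1)`, and
bad (work `W`, profit 1) otherwise.

Online: a packet's type is invisible until its first processing cycle, so a fraction `1/N` of the
packets an algorithm touches are good on average (`exists_serve_congr`,
`mul_card_filter_eq_of_update`). `N` balances the two types: finding a good packet costs on average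
as much time as the same profit costs by finishing bad ones. The charging inequality
`Schedule.throughput_le` turns this into expected throughput at most `T/(W-1) + BV`, where `BV` pays
for the buffer left after the last arrival (`sum_throughput_le`).

Offline: serving one good packet in each cycle where one arrives earns `V T (1 - (1 - 1/N)^M)` on
average. With `T = (W-1)BV` both online terms coincide, and the quotient is exactly `lowerBound V W
1 M`.

The remaining claims are elementary estimates of `(1 - 1/N)^k`. -/

theorem one_sub_pow_le_one_sub_half_mul (x : ℝ) (k : ℕ) (hx0 : 0 ≤ x) (hx1 : x ≤ 1)
    (hk : k * x ≤ 1) : (1 - x) ^ k ≤ 1 - k * x / 2 := by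
  induction k with
  | zero => simp
  | succ n ih =>
    push_cast at hk ⊢
    have h := ih (by nlinarith)
    have h2 : (1 - x) ^ n * (1 - x) ≤ (1 - n * x / 2) * (1 - x) :=
      mul_le_mul_of_nonneg_right h (by linarith)
    rw [pow_succ]
    -- After expansion the claim reduces to `n * x ^ 2 ≤ x`, which `hk` supplies.
    nlinarith

theorem one_le_mul_sub_add_one_sub {V W W₀ : ℕ} (hV : 1 ≤ V) (hW₀W : W₀ ≤ W) (hW : 2 ≤ W)
    (h : W₀ < W ∨ 1 < V) : (1 : ℝ) ≤ (V : ℝ) * ((W : ℝ) - 1) + 1 - (W₀ : ℝ) := by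
  have hW' : (2 : ℝ) ≤ W := by exact_mod_cast hW
  rcases h with h | h
  · have h1 : (W₀ : ℝ) + 1 ≤ W := by exact_mod_cast h
    have h2 : (1 : ℝ) ≤ V := by exact_mod_cast hV
    nlinarith
  · have h1 : (W₀ : ℝ) ≤ W := by exact_mod_cast hW₀W
    have h2 : (2 : ℝ) ≤ V := by exact_mod_cast h
    nlinarith

/-- Removes `W₀` from the base: `1 - W₀ ≤ 0` only shrinks the denominator, and a denominator of at
least 1 keeps the base nonnegative. -/
theorem one_sub_one_div_pow_le {V W W₀ : ℕ} (k : ℕ) (hV : 1 ≤ V) (hW₀ : 1 ≤ W₀) (hW₀W : W₀ ≤ W)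
    (hW : 2 ≤ W) (h : W₀ < W ∨ 1 < V) :
    (1 - 1 / ((V : ℝ) * ((W : ℝ) - 1) + 1 - (W₀ : ℝ))) ^ k ≤
      (1 - 1 / ((V : ℝ) * ((W : ℝ) - 1))) ^ k := by
  have hN := one_le_mul_sub_add_one_sub hV hW₀W hW h
  have hW₀' : (1 : ℝ) ≤ W₀ := by exact_mod_cast hW₀
  have h1 : 1 / ((V : ℝ) * ((W : ℝ) - 1) + 1 - (W₀ : ℝ)) ≤ 1 := by
    rw [div_le_one (by linarith)]; exact hN
  apply pow_le_pow_left₀ (by linarith)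
  have : 1 / ((V : ℝ) * ((W : ℝ) - 1)) ≤ 1 / ((V : ℝ) * ((W : ℝ) - 1) + 1 - (W₀ : ℝ)) :=
    one_div_le_one_div_of_le (by linarith) (by linarith)
  linarith

theorem div_four_le_lowerBound {V W W₀ M : ℕ} (hV : 1 ≤ V) (hW₀ : 1 ≤ W₀) (hW₀W : W₀ ≤ W)
    (hW : 2 ≤ W) (h : W₀ < W ∨ 1 < V) (hM : (M : ℝ) ≤ (V : ℝ) * ((W : ℝ) - 1) / (W₀ : ℝ)) :
    (M : ℝ) / 4 ≤ lowerBound V W W₀ M := by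
  have hN := one_le_mul_sub_add_one_sub hV hW₀W hW h
  have hpow := one_sub_one_div_pow_le (M * W₀) hV hW₀ hW₀W hW h
  have hW₀' : (1 : ℝ) ≤ W₀ := by exact_mod_cast hW₀
  unfold lowerBound
  set a : ℝ := (V : ℝ) * ((W : ℝ) - 1) with ha
  have ha1 : 1 ≤ a := by linarith
  rw [le_div_iff₀ (by linarith)] at hM
  have hb := one_sub_pow_le_one_sub_half_mul (1 / a) (M * W₀) (by positivity)
    (by rw [div_le_one (by linarith)]; exact ha1)
    (by push_cast; rw [mul_one_div, div_le_one (by linarith)]; exact hM)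
  push_cast at hb
  calc (M : ℝ) / 4 = a / (2 * W₀) * (M * W₀ * (1 / a) / 2) := by
        field_simp
        norm_num
    _ ≤ _ := mul_le_mul_of_nonneg_left (by linarith) (by positivity)

theorem lt_lowerBound {V W W₀ M : ℕ} (hV : 1 ≤ V) (hW₀ : 1 ≤ W₀) (hW₀W : W₀ ≤ W)
    (hW : 2 ≤ W) (h : W₀ < W ∨ 1 < V) (hM : (V : ℝ) * ((W : ℝ) - 1) / (W₀ : ℝ) < (M : ℝ)) :
    (Real.exp 1 - 1) / (4 * Real.exp 1) * ((V : ℝ) * (W : ℝ) / (W₀ : ℝ)) <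
      lowerBound V W W₀ M := by
  have hN := one_le_mul_sub_add_one_sub hV hW₀W hW h
  have hpow := one_sub_one_div_pow_le (M * W₀) hV hW₀ hW₀W hW h
  have hW₀' : (1 : ℝ) ≤ W₀ := by exact_mod_cast hW₀
  have hV' : (1 : ℝ) ≤ V := by exact_mod_cast hV
  have hW' : (2 : ℝ) ≤ W := by exact_mod_cast hW
  -- `W ≥ 2` gives `W - 1 ≥ W / 2`; with the 2 in `lowerBound` this makes the 4 in the constant.
  have haW : (V : ℝ) * W / 2 ≤ (V : ℝ) * ((W : ℝ) - 1) := by nlinarith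
  unfold lowerBound
  set a : ℝ := (V : ℝ) * ((W : ℝ) - 1) with ha
  have ha1 : 1 ≤ a := by linarith
  have hale : 1 / a ≤ 1 := by rw [div_le_one (by linarith)]; exact ha1
  rw [div_lt_iff₀ (by linarith)] at hM
  have hexp : (1 - 1 / a) ^ (M * W₀) < Real.exp (-1) := by
    calc (1 - 1 / a) ^ (M * W₀) ≤ Real.exp (-(1 / a)) ^ (M * W₀) :=
          pow_le_pow_left₀ (by linarith) (Real.one_sub_le_exp_neg _) _
      _ = Real.exp ((M * W₀ : ℕ) * (-(1 / a))) := (Real.exp_nat_mul _ _).symm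
      _ < Real.exp (-1) := by
          apply Real.exp_lt_exp.2
          have : 1 < (M : ℝ) * W₀ / a := by rw [one_lt_div (by linarith)]; exact hM
          push_cast
          calc (M : ℝ) * W₀ * (-(1 / a)) = -((M : ℝ) * W₀ / a) := by ring
            _ < -1 := by linarith
  have he : (Real.exp 1 - 1) / (4 * Real.exp 1) = (1 - Real.exp (-1)) / 4 := by
    rw [Real.exp_neg]
    field_simp
  have he1 : Real.exp (-1) < 1 := by rw [Real.exp_lt_one_iff]; norm_num
  rw [he]
  calc (1 - Real.exp (-1)) / 4 * ((V : ℝ) * W / W₀)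
      = ((V : ℝ) * W / 2) / (2 * W₀) * (1 - Real.exp (-1)) := by ring
    _ ≤ a / (2 * W₀) * (1 - Real.exp (-1)) := by
        apply mul_le_mul_of_nonneg_right _ (by linarith)
        gcongr
    _ < _ := mul_lt_mul_of_pos_left (by linarith) (by positivity)

/-! ### Observations do not depend on packets that have not been processed -/

/-- The history at `t` contains reveals only from cycles before `t`, so altering `q` invisibly
cannot matter until after its first processing. -/
theorem history_congr (A : OnlineAlg) {σ τ : Input} {q : PacketId}
    (hv : ∀ t, visible σ t = visible τ t) (hp : ∀ r, r ≠ q → packet? σ r = packet? τ r) (t : ℕ)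
    (h : ∀ s < t, (A.run σ).serve s ≠ some q) : A.history τ t = A.history σ t := by
  induction t with
  | zero => simp [OnlineAlg.history, hv]
  | succ n ih =>
    have ih' := ih fun s hs => h s (by omega)
    have hr : reveal τ (A (A.history σ n)).2 = reveal σ (A (A.history σ n)).2 := by
      have hn : (A (A.history σ n)).2 ≠ some q := h n (by omega)
      cases hs : (A (A.history σ n)).2 with
      | none => rfl
      | some r =>
        have : r ≠ q := fun e => hn (by rw [hs, e])
        simp [reveal, hp r this]
    simp only [OnlineAlg.history, ih', hv, hr]

theorem exists_serve_congr (A : OnlineAlg) {σ τ : Input} {q : PacketId} {T : ℕ}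
    (hv : ∀ t, visible σ t = visible τ t) (hp : ∀ r, r ≠ q → packet? σ r = packet? τ r)
    (h : ∃ t < T, (A.run σ).serve t = some q) : ∃ t < T, (A.run τ).serve t = some q := by
  classical
  -- At the first cycle serving `q`, both histories still agree, hence so does the decision.
  obtain ⟨n, ⟨hnT, hn⟩, hmin⟩ : ∃ n, (n < T ∧ (A.run σ).serve n = some q) ∧
      ∀ s < n, ¬(s < T ∧ (A.run σ).serve s = some q) :=
    ⟨Nat.find h, Nat.find_spec h, fun _ => Nat.find_min h⟩
  have := history_congr A hv hp n fun s hs e => hmin s hs ⟨hs.trans hnT, e⟩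
  refine ⟨n, hnT, ?_⟩
  rw [← hn]
  simp only [OnlineAlg.run, this]

/-! ### Feasible schedules -/

theorem arrivalList_eq_nil {σ : Input} {t : ℕ} (h : σ.length ≤ t) : arrivalList σ t = [] :=
  List.getD_eq_default _ _ h

theorem arrivals_eq_empty {σ : Input} {t : ℕ} (h : σ.length ≤ t) : arrivals σ t = ∅ := by
  simp [arrivals, arrivalList_eq_nil h]

theorem profitOf_le {V W W₀ M : ℕ} {σ : Input} (h : Admissible V W W₀ M σ) (q : PacketId) :
    profitOf σ q ≤ V := by
  unfold profitOf packet? arrivalList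
  cases hq : (σ.getD q.1 [])[q.2]? with
  | none => simp
  | some p =>
    have hp : p ∈ σ.getD q.1 [] := List.mem_of_getElem? hq
    have hlt : q.1 < σ.length := by
      by_contra hlt
      rw [List.getD_eq_default _ _ (by omega)] at hp
      simp at hp
    rw [List.getD_eq_getElem _ _ hlt] at hp
    simpa using ((h _ (List.getElem_mem hlt)).1 p hp).2.2

theorem Schedule.Feasible.keep_subset {S : Schedule} {B : ℕ} {σ : Input} (h : S.Feasible B σ)
    {t : ℕ} (ht : σ.length ≤ t) : S.keep t ⊆ S.keep σ.length := by
  induction t, ht using Nat.le_induction with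
  | base => exact subset_rfl
  | succ n hn ih =>
    refine ((h (n + 1)).1).trans ?_
    rw [arrivals_eq_empty (by omega), Finset.union_empty]
    exact Finset.sdiff_subset.trans ih

theorem Schedule.sum_servedBefore_le (S : Schedule) (D : Finset PacketId) (T : ℕ) :
    ∑ q ∈ D, S.servedBefore q T ≤ T := by
  classical
  simp only [Schedule.servedBefore, Finset.card_filter]
  rw [Finset.sum_comm]
  calc _ ≤ ∑ _s ∈ Finset.range T, 1 := by
        refine Finset.sum_le_sum fun s _ => ?_
        rw [← Finset.card_filter]
        refine Finset.card_le_one.2 fun a ha b hb => ?_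
        have h1 := (Finset.mem_filter.1 ha).2
        have h2 := (Finset.mem_filter.1 hb).2
        rw [h1] at h2
        exact Option.some_injective _ h2
    _ = T := by simp

open Classical in
/-- The packets which receive some processing while packets are still arriving. -/
noncomputable def Schedule.touched (S : Schedule) (σ : Input) : Finset PacketId :=
  (allIds σ).filter fun q => ∃ t < σ.length, S.serve t = some q

/-- Each touched packet is charged its processing time, plus a credit `V * (W - 1)` if its work is
1. This pays `W - 1` times its profit (if completed during the arrivals) and one extra unit. -/
theorem Schedule.throughput_le {S : Schedule} {V W W₀ M B : ℕ} {σ : Input}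
    (hσ : Admissible V W W₀ M σ) (hS : S.Feasible B σ) (hW : 1 ≤ W)
    (hpk : ∀ q ∈ allIds σ, (workOf σ q = 1 ∧ profitOf σ q = V) ∨
      (workOf σ q = W ∧ profitOf σ q = 1)) :
    (W - 1) * S.throughput σ + (S.touched σ).card ≤
      V * (W - 1) * ((S.touched σ).filter fun q => workOf σ q = 1).card + σ.length +
        (W - 1) * (B * V) := by
  classical
  set P := (allIds σ).filter fun q => ∃ t < σ.length, q ∈ S.completed σ t with hP
  have hmono : ∀ q t, t < σ.length → S.servedBefore q (t + 1) ≤ S.servedBefore q σ.length := by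
    intro q t ht
    refine Finset.card_le_card (Finset.filter_subset_filter _ ?_)
    intro s hs
    simp only [Finset.mem_range] at hs ⊢
    omega
  have hPserved : ∀ q ∈ P, workOf σ q ≤ S.servedBefore q σ.length := by
    intro q hq
    obtain ⟨t, ht, hc⟩ := (Finset.mem_filter.1 hq).2
    exact ((Finset.mem_filter.1 hc).2).trans (hmono q t ht)
  have hserved : ∀ q, 1 ≤ S.servedBefore q σ.length ↔ ∃ t < σ.length, S.serve t = some q := by
    intro q
    rw [Nat.one_le_iff_ne_zero, Schedule.servedBefore, Finset.card_ne_zero, Finset.filter_nonempty_iff]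
    simp
  have hPD : P ⊆ S.touched σ := by
    intro q hq
    have hid := (Finset.mem_filter.1 hq).1
    refine Finset.mem_filter.2 ⟨hid, (hserved q).1 (le_trans ?_ (hPserved q hq))⟩
    rcases hpk q hid with h | h <;> omega
  -- Packets completed after the arrivals end all lie in the buffer at cycle `σ.length`, which holds
  -- at most `B`.
  have h1 : S.throughput σ ≤ ∑ q ∈ P, profitOf σ q + B * V := by
    calc S.throughput σ ≤ ∑ q ∈ P ∪ S.keep σ.length, profitOf σ q := by
          refine Finset.sum_le_sum_of_subset fun q hq => ?_
          obtain ⟨hid, t, ht⟩ := Finset.mem_filter.1 hq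
          rcases lt_or_ge t σ.length with hlt | hge
          · exact Finset.mem_union_left _ (Finset.mem_filter.2 ⟨hid, t, hlt, ht⟩)
          · exact Finset.mem_union_right _ (hS.keep_subset hge (Finset.mem_filter.1 ht).1)
      _ ≤ ∑ q ∈ P, profitOf σ q + ∑ q ∈ S.keep σ.length, profitOf σ q := by
          rw [← Finset.sum_union_inter]; exact Nat.le_add_right _ _
      _ ≤ _ := by
          refine Nat.add_le_add_left ?_ _
          calc _ ≤ ∑ _q ∈ S.keep σ.length, V := Finset.sum_le_sum fun q _ => profitOf_le hσ q
            _ = (S.keep σ.length).card * V := by simp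
            _ ≤ B * V := Nat.mul_le_mul_right _ (hS _).2.1
  have h2 : ∑ q ∈ S.touched σ, ((if q ∈ P then (W - 1) * profitOf σ q else 0) + 1) ≤
      ∑ q ∈ S.touched σ,
        ((if workOf σ q = 1 then V * (W - 1) else 0) + S.servedBefore q σ.length) := by
    refine Finset.sum_le_sum fun q hq => ?_
    obtain ⟨hid, hs⟩ := Finset.mem_filter.1 hq
    have hs1 := (hserved q).2 hs
    by_cases hqP : q ∈ P
    · have hw := hPserved q hqP
      rw [if_pos hqP]
      rcases hpk q hid with ⟨h, h'⟩ | ⟨h, h'⟩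
      · rw [if_pos h, h', mul_comm V]
        omega
      · rw [h', mul_one]
        omega
    · rw [if_neg hqP]
      omega
  rw [Finset.sum_add_distrib, Finset.sum_add_distrib, Finset.sum_ite_mem,
    Finset.inter_eq_right.2 hPD, ← Finset.mul_sum, ← Finset.sum_filter] at h2
  simp only [Finset.sum_const, smul_eq_mul, mul_one] at h2
  have h3 := S.sum_servedBefore_le (S.touched σ) σ.length
  have h4 := Nat.mul_le_mul_left (W - 1) h1
  rw [mul_add] at h4
  rw [mul_comm (Finset.card _) (V * (W - 1))] at h2
  omega

/-! ### The random input -/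

/-- `T` cycles with `M` unknown packets each; a packet whose coin shows `0` has work `1` and
profit `V`, all others have work `W` and profit `1`. -/
def coinInput (V W : ℕ) {T M N : ℕ} (c : Fin T × Fin M → Fin N) : Input :=
  List.ofFn fun t => List.ofFn fun i =>
    if (c (t, i)).val = 0 then ⟨1, V, false⟩ else ⟨W, 1, false⟩

/-- The identifier of a packet of `coinInput`. -/
def coinId (T M : ℕ) : Fin T × Fin M ↪ PacketId where
  toFun j := (j.1.val, j.2.val)
  inj' a b h := by
    simp only [Prod.mk.injEq] at h
    exact Prod.ext (Fin.ext h.1) (Fin.ext h.2)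

section coinInput

variable {V W T M N : ℕ} (c : Fin T × Fin M → Fin N)

@[simp] theorem length_coinInput : (coinInput V W c).length = T := by simp [coinInput]

theorem arrivalList_coinInput (t : Fin T) : arrivalList (coinInput V W c) t =
    List.ofFn fun i => if (c (t, i)).val = 0 then ⟨1, V, false⟩ else ⟨W, 1, false⟩ := by
  simp [arrivalList, coinInput]

theorem packet?_coinInput (j : Fin T × Fin M) : packet? (coinInput V W c) (coinId T M j) =
    some (if (c j).val = 0 then ⟨1, V, false⟩ else ⟨W, 1, false⟩) := by
  unfold packet?
  change (arrivalList _ (j.1 : ℕ))[(j.2 : ℕ)]? = _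
  rw [arrivalList_coinInput]
  simp

theorem packet?_coinInput_of_notMem {q : PacketId} (hq : ∀ j, coinId T M j ≠ q) :
    packet? (coinInput V W c) q = none := by
  unfold packet?
  by_cases h1 : q.1 < T
  · have := arrivalList_coinInput (V := V) (W := W) c ⟨q.1, h1⟩
    simp only at this
    rw [this, List.getElem?_eq_none]
    by_contra h2
    rw [List.length_ofFn, not_le] at h2
    exact hq (⟨q.1, h1⟩, ⟨q.2, h2⟩) rfl
  · simp [arrivalList_eq_nil (show (coinInput V W c).length ≤ q.1 by
      rw [length_coinInput]; omega)]

theorem mem_arrivals_coinInput (j : Fin T × Fin M) :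
    coinId T M j ∈ arrivals (coinInput V W c) j.1 := by
  refine Finset.mem_image.2 ⟨j.2, ?_, rfl⟩
  simp [arrivalList_coinInput]

theorem allIds_coinInput : allIds (coinInput V W c) = Finset.univ.map (coinId T M) := by
  ext q
  simp only [allIds, Finset.mem_biUnion, Finset.mem_range, length_coinInput, Finset.mem_map,
    Finset.mem_univ, true_and]
  constructor
  · rintro ⟨t, ht, hq⟩
    obtain ⟨i, hi, rfl⟩ := Finset.mem_image.1 hq
    have := arrivalList_coinInput (V := V) (W := W) c ⟨t, ht⟩
    simp only at this
    rw [this, Finset.mem_range, List.length_ofFn] at hi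
    exact ⟨(⟨t, ht⟩, ⟨i, hi⟩), rfl⟩
  · rintro ⟨j, rfl⟩
    exact ⟨j.1, j.1.2, mem_arrivals_coinInput c j⟩

theorem workOf_coinInput (j : Fin T × Fin M) : workOf (coinInput V W c) (coinId T M j) =
    if (c j).val = 0 then 1 else W := by
  rw [workOf, packet?_coinInput]
  split_ifs <;> rfl

theorem profitOf_coinInput (j : Fin T × Fin M) : profitOf (coinInput V W c) (coinId T M j) =
    if (c j).val = 0 then V else 1 := by
  rw [profitOf, packet?_coinInput]
  split_ifs <;> rfl

theorem admissible_coinInput (hV : 1 ≤ V) (hW : 1 ≤ W) : Admissible V W 1 M (coinInput V W c) := by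
  intro a ha
  obtain ⟨t, rfl⟩ := (List.mem_ofFn' _ _).1 ha
  refine ⟨fun p hp => ?_, List.countP_le_length.trans (by simp)⟩
  obtain ⟨i, rfl⟩ := (List.mem_ofFn' _ _).1 hp
  dsimp only
  split_ifs <;> simp [hV, hW]

theorem visible_coinInput (c' : Fin T × Fin M → Fin N) (t : ℕ) :
    visible (coinInput V W c) t = visible (coinInput V W c') t := by
  by_cases ht : t < T
  · have h1 := arrivalList_coinInput (V := V) (W := W) c ⟨t, ht⟩
    have h2 := arrivalList_coinInput (V := V) (W := W) c' ⟨t, ht⟩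
    simp only at h1 h2
    rw [visible, visible, h1, h2, List.map_ofFn, List.map_ofFn]
    congr 1
    funext i
    simp only [Function.comp]
    split_ifs <;> simp_all
  · simp [visible,
      arrivalList_eq_nil (show (coinInput V W c).length ≤ t by rw [length_coinInput]; omega),
      arrivalList_eq_nil (show (coinInput V W c').length ≤ t by rw [length_coinInput]; omega)]

theorem packet?_coinInput_update (j : Fin T × Fin M) (x : Fin N) {r : PacketId}
    (hr : r ≠ coinId T M j) : packet? (coinInput V W c) r =
      packet? (coinInput V W (Function.update c j x)) r := by
  by_cases h : ∃ i, coinId T M i = r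
  · obtain ⟨i, rfl⟩ := h
    have : i ≠ j := fun e => hr (by rw [e])
    rw [packet?_coinInput, packet?_coinInput, Function.update_of_ne this]
  · push Not at h
    rw [packet?_coinInput_of_notMem _ h, packet?_coinInput_of_notMem _ h]

end coinInput

/-! ### Counting coin outcomes -/

/-- An event unaffected by re-tossing coin `j` is independent of that coin, so its fibers over the
`N` values are equinumerous. -/
theorem mul_card_filter_eq_of_update {ι : Type*} [Fintype ι] [DecidableEq ι] {N : ℕ}
    (j : ι) (P : (ι → Fin N) → Prop) [DecidablePred P]
    (hP : ∀ c x, P c → P (Function.update c j x)) :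
    N * (Finset.univ.filter fun c => P c ∧ (c j).val = 0).card =
      (Finset.univ.filter P).card := by
  have hfib := Finset.card_eq_sum_card_fiberwise (s := Finset.univ.filter P)
    (t := (Finset.univ : Finset (Fin N))) (f := fun c => c j) (fun _ _ => by simp)
  rw [hfib]
  have hall : ∀ x : Fin N, ((Finset.univ.filter P).filter fun c => c j = x).card =
      (Finset.univ.filter fun c => P c ∧ (c j).val = 0).card := by
    intro x
    have hN : 0 < N := x.pos
    refine Finset.card_bij' (fun c _ => Function.update c j ⟨0, hN⟩)
      (fun c _ => Function.update c j x) ?_ ?_ ?_ ?_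
    · intro c hc
      simp only [Finset.mem_filter, Finset.mem_univ, true_and] at hc ⊢
      exact ⟨hP _ _ hc.1, by simp⟩
    · intro c hc
      simp only [Finset.mem_filter, Finset.mem_univ, true_and] at hc ⊢
      exact ⟨hP _ _ hc.1, by simp⟩
    · intro c hc
      simp only [Finset.mem_filter, Finset.mem_univ, true_and] at hc
      simp [← hc.2]
    · intro c hc
      simp only [Finset.mem_filter, Finset.mem_univ, true_and] at hc
      have : c j = ⟨0, hN⟩ := Fin.ext hc.2
      simp [← this]
  rw [Finset.sum_congr rfl fun x _ => hall x]
  simp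

theorem card_filter_exists_coin_eq_zero {T M N : ℕ} (hN : 1 ≤ N) (t : Fin T) :
    ((Finset.univ.filter fun c : Fin T × Fin M → Fin N => ∃ i, (c (t, i)).val = 0).card : ℝ) =
      (N : ℝ) ^ (T * M) * (1 - (1 - 1 / (N : ℝ)) ^ M) := by
  have hN0 : (N : ℝ) ≠ 0 := by positivity
  have hcompl := Finset.card_filter_add_card_filter_not (s := Finset.univ)
    (fun c : Fin T × Fin M → Fin N => ∃ i, (c (t, i)).val = 0)
  -- The complementary event constrains each coin separately: it is a product set.
  have hbad : (Finset.univ.filter fun c : Fin T × Fin M → Fin N =>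
      ¬ ∃ i, (c (t, i)).val = 0) = Fintype.piFinset fun j : Fin T × Fin M =>
        if j.1 = t then Finset.univ.erase (⟨0, hN⟩ : Fin N) else Finset.univ := by
    ext c
    simp only [Finset.mem_filter, Finset.mem_univ, true_and, Fintype.mem_piFinset, not_exists]
    constructor
    · rintro h ⟨s, i⟩
      by_cases hs : s = t
      · subst hs
        simpa [Fin.ext_iff] using h i
      · simp [hs]
    · intro h i
      simpa [Fin.ext_iff] using h (t, i)
  have hcard : ((Finset.univ.filter fun c : Fin T × Fin M → Fin N =>
      ¬ ∃ i, (c (t, i)).val = 0).card : ℝ) = (N : ℝ) ^ (T * M) * (1 - 1 / (N : ℝ)) ^ M := by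
    rw [hbad, Fintype.card_piFinset]
    push_cast
    have : ∀ j : Fin T × Fin M, (((if j.1 = t then Finset.univ.erase (⟨0, hN⟩ : Fin N)
        else Finset.univ).card : ℕ) : ℝ) = N * (if j.1 = t then (1 - 1 / (N : ℝ)) else 1) := by
      intro j
      split_ifs
      · rw [Finset.card_erase_of_mem (Finset.mem_univ _), Finset.card_univ, Fintype.card_fin,
          Nat.cast_sub hN]
        field_simp
        simp
      · simp
    rw [Finset.prod_congr rfl fun j _ => this j, Finset.prod_mul_distrib, Fintype.prod_prod_type,
      Fintype.prod_prod_type]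
    simp [Finset.prod_ite_eq', ← pow_mul, mul_comm]
  have htot : (Finset.univ : Finset (Fin T × Fin M → Fin N)).card = N ^ (T * M) := by
    simp
  rw [htot] at hcompl
  have hcompl' := congrArg (Nat.cast (R := ℝ)) hcompl
  push_cast at hcompl'
  rw [hcard] at hcompl'
  linarith

/-! ### Online and offline throughput on the random input -/

theorem sum_throughput_le (A : OnlineAlg) {V W T M B : ℕ} (hV : 1 ≤ V) (hW : 1 ≤ W)
    (hA : ∀ σ, Admissible V W 1 M σ → (A.run σ).Feasible B σ) :
    (W - 1) * ∑ c : Fin T × Fin M → Fin (V * (W - 1)),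
        (A.run (coinInput V W c)).throughput (coinInput V W c) ≤
      (V * (W - 1)) ^ (T * M) * (T + (W - 1) * (B * V)) := by
  classical
  rcases Nat.lt_or_ge 1 W with hW2 | hW2
  swap
  · simp [show W - 1 = 0 by omega]
  set N := V * (W - 1) with hN
  let P : Fin T × Fin M → (Fin T × Fin M → Fin N) → Prop := fun j c =>
    ∃ t < T, (A.run (coinInput V W c)).serve t = some (coinId T M j)
  have htouched : ∀ c : Fin T × Fin M → Fin N,
      ((A.run (coinInput V W c)).touched (coinInput V W c)) =
        (Finset.univ.filter fun j => P j c).map (coinId T M) := by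
    intro c
    rw [Schedule.touched, allIds_coinInput, Finset.filter_map]
    simp only [length_coinInput, P, Function.comp_def]
  have hgood : ∀ c : Fin T × Fin M → Fin N,
      (((A.run (coinInput V W c)).touched (coinInput V W c)).filter
        fun q => workOf (coinInput V W c) q = 1).card =
        (Finset.univ.filter fun j => P j c ∧ (c j).val = 0).card := by
    intro c
    rw [htouched, Finset.filter_map, Finset.card_map, Finset.filter_filter]
    congr 1
    refine Finset.filter_congr fun j _ => and_congr_right fun _ => ?_
    simp only [Function.comp, workOf_coinInput]
    split_ifs with h
    · simp [h]
    · simp only [h, iff_false]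
      omega
  have hswap : ∀ (Q : Fin T × Fin M → (Fin T × Fin M → Fin N) → Prop)
      [∀ j c, Decidable (Q j c)], ∑ c, (Finset.univ.filter fun j => Q j c).card =
        ∑ j, (Finset.univ.filter fun c => Q j c).card := by
    intro Q _
    simp only [Finset.card_filter]
    exact Finset.sum_comm
  -- Whether `j` is ever touched does not depend on its own coin.
  have hupd : ∀ j c x, P j c → P j (Function.update c j x) := fun j c x h =>
    exists_serve_congr A (visible_coinInput c _)
      (fun r hr => packet?_coinInput_update c j x hr) h
  have hfair : N * ∑ c, (Finset.univ.filter fun j => P j c ∧ (c j).val = 0).card =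
      ∑ c, (Finset.univ.filter fun j => P j c).card := by
    rw [hswap fun j c => P j c ∧ (c j).val = 0, hswap P, Finset.mul_sum]
    exact Finset.sum_congr rfl fun j _ => mul_card_filter_eq_of_update j (P j) (hupd j)
  have hpath : ∀ c : Fin T × Fin M → Fin N,
      (W - 1) * (A.run (coinInput V W c)).throughput (coinInput V W c) +
        (Finset.univ.filter fun j => P j c).card ≤
      N * (Finset.univ.filter fun j => P j c ∧ (c j).val = 0).card + (T + (W - 1) * (B * V)) := by
    intro c
    have hadm := admissible_coinInput (V := V) (W := W) c hV hW
    have := Schedule.throughput_le hadm (hA _ hadm) hW (fun q hq => by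
      rw [allIds_coinInput] at hq
      obtain ⟨j, -, rfl⟩ := Finset.mem_map.1 hq
      rw [workOf_coinInput, profitOf_coinInput]
      split_ifs <;> simp)
    rw [hgood, htouched, Finset.card_map, length_coinInput, ← hN] at this
    omega
  have hsum := Finset.sum_le_sum fun c (_ : c ∈ Finset.univ) => hpath c
  rw [Finset.sum_add_distrib, Finset.sum_add_distrib, ← Finset.mul_sum, ← Finset.mul_sum,
    hfair] at hsum
  simp only [Finset.sum_const, Finset.card_univ, Fintype.card_pi, Finset.prod_const,
    Fintype.card_fin, Fintype.card_prod, smul_eq_mul] at hsum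
  omega

open Classical in
/-- The offline schedule which in each cycle processes a packet of work `1`, if one arrives. -/
noncomputable def greedySchedule {T M N : ℕ} (c : Fin T × Fin M → Fin N) : Schedule where
  serve t := if h : ∃ j : Fin T × Fin M, j.1.val = t ∧ (c j).val = 0 then
    some (coinId T M h.choose) else none
  keep t := if h : ∃ j : Fin T × Fin M, j.1.val = t ∧ (c j).val = 0 then
    {coinId T M h.choose} else ∅

/-- Only a packet of the current cycle is ever held, so one buffer slot suffices. -/
theorem feasible_greedySchedule {V W T M N B : ℕ} (hB : 1 ≤ B) (c : Fin T × Fin M → Fin N) :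
    (greedySchedule c).Feasible B (coinInput V W c) := by
  intro t
  by_cases h : ∃ j : Fin T × Fin M, j.1.val = t ∧ (c j).val = 0
  · simp only [greedySchedule, dif_pos h]
    refine ⟨?_, by simpa using hB, by simp⟩
    rw [Finset.singleton_subset_iff]
    have := mem_arrivals_coinInput (V := V) (W := W) c h.choose
    rw [h.choose_spec.1] at this
    exact Finset.mem_union_right _ this
  · simp only [greedySchedule, dif_neg h]
    simp

theorem le_throughput_greedySchedule {V W T M N : ℕ} (c : Fin T × Fin M → Fin N) :
    V * (Finset.univ.filter fun t : Fin T => ∃ i, (c (t, i)).val = 0).card ≤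
      (greedySchedule c).throughput (coinInput V W c) := by
  classical
  have hex : ∀ t ∈ Finset.univ.filter fun t : Fin T => ∃ i, (c (t, i)).val = 0,
      ∃ j : Fin T × Fin M, j.1.val = t.val ∧ (c j).val = 0 := by
    intro t ht
    obtain ⟨i, hi⟩ := (Finset.mem_filter.1 ht).2
    exact ⟨(t, i), rfl, hi⟩
  set G := Finset.univ.filter fun t : Fin T => ∃ i, (c (t, i)).val = 0 with hG
  let f : {t // t ∈ G} → PacketId := fun t => coinId T M (hex t.1 t.2).choose
  -- The chosen packets arrive in different cycles.
  have hf : Function.Injective f := by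
    intro s t hst
    have h := (coinId T M).injective hst
    have h1 := (hex s.1 s.2).choose_spec.1
    rw [h, (hex t.1 t.2).choose_spec.1] at h1
    exact Subtype.ext (Fin.ext h1.symm)
  calc V * G.card = ∑ q ∈ G.attach.image f, V := by
        rw [Finset.sum_const, Finset.card_image_of_injective _ hf, Finset.card_attach, smul_eq_mul,
          mul_comm]
    _ = ∑ q ∈ G.attach.image f, profitOf (coinInput V W c) q := by
        refine Finset.sum_congr rfl fun q hq => ?_
        obtain ⟨t, -, rfl⟩ := Finset.mem_image.1 hq
        rw [profitOf_coinInput, if_pos (hex t.1 t.2).choose_spec.2]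
    _ ≤ _ := by
        refine Finset.sum_le_sum_of_subset fun q hq => ?_
        obtain ⟨t, -, rfl⟩ := Finset.mem_image.1 hq
        refine Finset.mem_filter.2 ⟨?_, t.1.val, Finset.mem_filter.2 ⟨?_, ?_⟩⟩
        · rw [allIds_coinInput]
          exact Finset.mem_map_of_mem _ (Finset.mem_univ _)
        · simp only [greedySchedule, dif_pos (hex t.1 t.2)]
          exact Finset.mem_singleton_self _
        · rw [workOf_coinInput, if_pos (hex t.1 t.2).choose_spec.2, Schedule.servedBefore,
            Nat.one_le_iff_ne_zero, Finset.card_ne_zero]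
          refine ⟨t.1.val, Finset.mem_filter.2 ⟨by simp, ?_⟩⟩
          simp only [greedySchedule, dif_pos (hex t.1 t.2)]
          rfl

theorem le_sum_throughput_greedySchedule {V W T M N : ℕ} (hN : 1 ≤ N) :
    (V : ℝ) * T * ((N : ℝ) ^ (T * M) * (1 - (1 - 1 / (N : ℝ)) ^ M)) ≤
      ∑ c : Fin T × Fin M → Fin N,
        ((greedySchedule c).throughput (coinInput V W c) : ℝ) := by
  classical
  calc (V : ℝ) * T * ((N : ℝ) ^ (T * M) * (1 - (1 - 1 / (N : ℝ)) ^ M))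
      = V * ∑ t : Fin T, ((Finset.univ.filter fun c : Fin T × Fin M → Fin N =>
          ∃ i, (c (t, i)).val = 0).card : ℝ) := by
        rw [Finset.sum_congr rfl fun t _ => card_filter_exists_coin_eq_zero hN t]
        simp [mul_assoc]
    _ = ∑ c : Fin T × Fin M → Fin N,
        ((V * (Finset.univ.filter fun t : Fin T => ∃ i, (c (t, i)).val = 0).card : ℕ) : ℝ) := by
        push_cast
        rw [← Finset.mul_sum]
        congr 1
        simp only [Finset.card_filter]
        push_cast
        exact Finset.sum_comm
    _ ≤ _ := Finset.sum_le_sum fun c _ => by exact_mod_cast le_throughput_greedySchedule c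

/-! ### From deterministic to randomized algorithms, and the final comparison. -/

theorem Schedule.throughput_le_sum (S : Schedule) (σ : Input) :
    S.throughput σ ≤ ∑ q ∈ allIds σ, profitOf σ q := by
  classical
  exact Finset.sum_le_sum_of_subset (Finset.filter_subset _ _)

theorem RandomizedAlg.sum_expectedThroughput_le {V W M B : ℕ} (R : RandomizedAlg V W 1 M B) (T : ℕ)
    (hV : 1 ≤ V) (hW : 1 ≤ W) :
    ((W : ℝ) - 1) * ∑ c : Fin T × Fin M → Fin (V * (W - 1)),
        R.expectedThroughput (coinInput V W c) ≤
      ((V * (W - 1) : ℕ) : ℝ) ^ (T * M) * (T + ((W : ℝ) - 1) * (B * V)) := by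
  let _ : MeasurableSpace R.Ω := R.mΩ
  have _ : IsProbabilityMeasure R.μ := R.prob
  have hint : ∀ c : Fin T × Fin M → Fin (V * (W - 1)), Integrable (fun ω =>
      (((R.alg ω).run (coinInput V W c)).throughput (coinInput V W c) : ℝ)) R.μ := by
    intro c
    have hm := R.measurable_throughput _ (admissible_coinInput (V := V) (W := W) c hV hW)
    refine Integrable.of_bound (C := ((∑ q ∈ allIds (coinInput V W c),
      profitOf (coinInput V W c) q : ℕ) : ℝ))
      ((measurable_from_top (f := (Nat.cast : ℕ → ℝ))).comp hm).aestronglyMeasurable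
      (Filter.Eventually.of_forall fun ω => ?_)
    rw [Real.norm_of_nonneg (Nat.cast_nonneg _)]
    exact_mod_cast Schedule.throughput_le_sum _ _
  unfold RandomizedAlg.expectedThroughput
  rw [← integral_finsetSum _ fun c _ => hint c, ← integral_const_mul]
  have hle : ∀ ω, ((W : ℝ) - 1) * ∑ c : Fin T × Fin M → Fin (V * (W - 1)),
      (((R.alg ω).run (coinInput V W c)).throughput (coinInput V W c) : ℝ) ≤
      ((V * (W - 1) : ℕ) : ℝ) ^ (T * M) * (T + ((W : ℝ) - 1) * (B * V)) := by
    intro ω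
    have h := sum_throughput_le (T := T) (R.alg ω) hV hW (R.feasible ω)
    rw [← Nat.cast_one, ← Nat.cast_sub hW]
    exact_mod_cast h
  calc _ ≤ ∫ _ω, (((V * (W - 1) : ℕ) : ℝ) ^ (T * M) * (T + ((W : ℝ) - 1) * (B * V))) ∂(R.μ) :=
        integral_mono ((integrable_finsetSum _ fun c _ => hint c).const_mul _)
          (integrable_const _) hle
    _ = _ := by simp

theorem RandomizedAlg.lowerBound_le {V W M B B' : ℕ} (hV : 1 ≤ V) (hW : 2 ≤ W) (hM : 1 ≤ M)
    (hB : 1 ≤ B) (hB' : 1 ≤ B') (R : RandomizedAlg V W 1 M B) {ρ : ℝ}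
    (hR : R.IsCompetitive B' ρ) : lowerBound V W 1 M ≤ ρ := by
  have hW1 : 1 ≤ W := by omega
  have hN : 1 ≤ V * (W - 1) := Nat.mul_pos hV (by omega)
  -- This length makes the end-of-input term in `halg` equal to `T`, so the bound becomes `T + T`.
  set T := (W - 1) * (B * V) with hT
  have hT1 : 1 ≤ T := Nat.mul_pos (by omega) (Nat.mul_pos hB hV)
  have halg := R.sum_expectedThroughput_le T hV hW1
  have hopt := le_sum_throughput_greedySchedule (V := V) (W := W) (T := T) (M := M) hN
  have hcomp : ∑ c : Fin T × Fin M → Fin (V * (W - 1)),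
      ((greedySchedule c).throughput (coinInput V W c) : ℝ) ≤
      ρ * ∑ c : Fin T × Fin M → Fin (V * (W - 1)), R.expectedThroughput (coinInput V W c) := by
    rw [Finset.mul_sum]
    exact Finset.sum_le_sum fun c _ => hR _ (admissible_coinInput c hV hW1) _
      (feasible_greedySchedule hB' c)
  have hnonneg : 0 ≤ ∑ c : Fin T × Fin M → Fin (V * (W - 1)),
      R.expectedThroughput (coinInput V W c) := by
    refine Finset.sum_nonneg fun c _ => ?_
    unfold RandomizedAlg.expectedThroughput
    exact integral_nonneg fun ω => Nat.cast_nonneg _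
  have hWr : (0 : ℝ) < (W : ℝ) - 1 := by
    have : (2 : ℝ) ≤ W := by exact_mod_cast hW
    linarith
  have hTr : (T : ℝ) = ((W : ℝ) - 1) * (B * V) := by
    rw [hT, Nat.cast_mul, Nat.cast_mul, Nat.cast_sub hW1, Nat.cast_one]
  have hNr : ((V * (W - 1) : ℕ) : ℝ) = (V : ℝ) * ((W : ℝ) - 1) := by
    rw [Nat.cast_mul, Nat.cast_sub hW1, Nat.cast_one]
  have hN1 : (1 : ℝ) ≤ (V : ℝ) * ((W : ℝ) - 1) := by rw [← hNr]; exact_mod_cast hN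
  rw [hNr, ← hTr] at halg
  rw [hNr] at hopt
  have hlb : lowerBound V W 1 M = (V : ℝ) * ((W : ℝ) - 1) / 2 *
      (1 - (1 - 1 / ((V : ℝ) * ((W : ℝ) - 1))) ^ M) := by
    simp [lowerBound]
  rw [hlb]
  set a : ℝ := (V : ℝ) * ((W : ℝ) - 1) with ha
  set p : ℝ := 1 - (1 - 1 / a) ^ M with hp
  set E := ∑ c : Fin T × Fin M → Fin (V * (W - 1)), R.expectedThroughput (coinInput V W c) with hE
  have hTpos : (0 : ℝ) < T := by exact_mod_cast hT1
  have hVpos : (0 : ℝ) < V := by exact_mod_cast hV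
  have hp0 : 0 < p := by
    have h1 : 1 / a ≤ 1 := by rw [div_le_one (by linarith)]; exact hN1
    have h2 : 0 < 1 / a := by positivity
    have := pow_lt_one₀ (sub_nonneg.2 h1) (by linarith) (show M ≠ 0 by omega)
    linarith
  have hpow : 0 < a ^ (T * M) := by positivity
  have hmain := hopt.trans hcomp
  -- Needed to multiply `halg` by `ρ`; it holds because the offline total is positive.
  have hρ : 0 < ρ := by
    by_contra hρ
    have h1 : ρ * E ≤ 0 := mul_nonpos_of_nonpos_of_nonneg (not_lt.1 hρ) hnonneg
    have h2 : 0 < (V : ℝ) * T * (a ^ (T * M) * p) := by positivity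
    linarith
  have h3 : a / 2 * p * (2 * T * a ^ (T * M)) ≤ ρ * (2 * T * a ^ (T * M)) := by
    calc a / 2 * p * (2 * T * a ^ (T * M)) = ((W : ℝ) - 1) * (V * T * (a ^ (T * M) * p)) := by
          rw [ha]; ring
      _ ≤ ((W : ℝ) - 1) * (ρ * E) := mul_le_mul_of_nonneg_left hmain hWr.le
      _ = ρ * (((W : ℝ) - 1) * E) := by ring
      _ ≤ ρ * (a ^ (T * M) * (T + T)) := mul_le_mul_of_nonneg_left halg hρ.le
      _ = _ := by ring
  exact le_of_mul_le_mul_right h3 (by positivity)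

theorem mul_min_le_lowerBound {V W M : ℕ} (hV : 1 ≤ V) (hW : 2 ≤ W) :
    (Real.exp 1 - 1) / (4 * Real.exp 1) * min ((V : ℝ) * (W : ℝ)) (M : ℝ) ≤
      lowerBound V W 1 M := by
  have he : 0 < Real.exp 1 := Real.exp_pos 1
  have he0 : 0 ≤ (Real.exp 1 - 1) / (4 * Real.exp 1) :=
    div_nonneg (by linarith [Real.add_one_le_exp (1 : ℝ)]) (by linarith)
  have he1 : (Real.exp 1 - 1) / (4 * Real.exp 1) ≤ 1 / 4 := by
    rw [div_le_div_iff₀ (by linarith) (by norm_num)]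
    linarith
  rcases le_or_gt (M : ℝ) ((V : ℝ) * ((W : ℝ) - 1) / ((1 : ℕ) : ℝ)) with h | h
  · have hlow := div_four_le_lowerBound hV le_rfl (by omega) hW (Or.inl (by omega)) h
    calc _ ≤ (Real.exp 1 - 1) / (4 * Real.exp 1) * (M : ℝ) :=
          mul_le_mul_of_nonneg_left (min_le_right _ _) he0
      _ ≤ 1 / 4 * (M : ℝ) := mul_le_mul_of_nonneg_right he1 (Nat.cast_nonneg _)
      _ ≤ _ := by linarith
  · have hlow := lt_lowerBound hV le_rfl (by omega) hW (Or.inl (by omega)) h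
    refine le_trans (mul_le_mul_of_nonneg_left (min_le_left _ _) he0) ?_
    rw [Nat.cast_one, div_one] at hlow
    exact hlow.le

end PacketQueue

theorem mainTheorem2 :
    -- small `M`
    (∀ V W W₀ M : ℕ, 1 ≤ V → 1 ≤ W₀ → W₀ ≤ W → 2 ≤ W → (W₀ < W ∨ 1 < V) → 1 ≤ M →
      (M : ℝ) ≤ (V : ℝ) * ((W : ℝ) - 1) / (W₀ : ℝ) →
      (M : ℝ) / 4 ≤ PacketQueue.lowerBound V W W₀ M) ∧
    -- large `M`
    (∀ V W W₀ M : ℕ, 1 ≤ V → 1 ≤ W₀ → W₀ ≤ W → 2 ≤ W → (W₀ < W ∨ 1 < V) →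
      (V : ℝ) * ((W : ℝ) - 1) / (W₀ : ℝ) < (M : ℝ) →
      (Real.exp 1 - 1) / (4 * Real.exp 1) * ((V : ℝ) * (W : ℝ) / (W₀ : ℝ)) <
        PacketQueue.lowerBound V W W₀ M) ∧
    -- the competitive ratio of every randomized algorithm, minimal work one
    (∀ V W M B B' : ℕ, 1 ≤ V → 2 ≤ W → 1 ≤ M → 1 ≤ B → 1 ≤ B' →
      ∀ (R : PacketQueue.RandomizedAlg V W 1 M B) (ρ : ℝ), R.IsCompetitive B' ρ →
        PacketQueue.lowerBound V W 1 M ≤ ρ ∧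
        (Real.exp 1 - 1) / (4 * Real.exp 1) * min ((V : ℝ) * (W : ℝ)) (M : ℝ) ≤ ρ) := by
  refine ⟨fun V W W₀ M hV hW₀ hW₀W hW h _ hM =>
      PacketQueue.div_four_le_lowerBound hV hW₀ hW₀W hW h hM,
    fun V W W₀ M hV hW₀ hW₀W hW h hM => PacketQueue.lt_lowerBound hV hW₀ hW₀W hW h hM, ?_⟩
  intro V W M B B' hV hW hM hB hB' R ρ hR
  have h := R.lowerBound_le hV hW hM hB hB' hR
  exact ⟨h, (PacketQueue.mul_min_le_lowerBound hV hW).trans h⟩
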